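/- All entropies are in bits: $S(\sigma)=-\operatorname{Tr}(\sigma\log_2\sigma)$. A qubit channel is a completely positive trace-preserving linear map $\mathcal N$ on $L(\mathbb C^2)$; it is entanglement-breaking (EB) if $(\mathcal N\otimes\mathcal I_k)(|\Psi\rangle\langle\Psi|)$ is separable for every $k$ and every unit vector $|\Psi\rangle\in\mathbb C^2\otimes\mathbb C^k$. Its entanglement-assisted capacity is $$C_{\rm E}(\mathcal N)=\max_{\rho,\psi_\rho}\big[S(\rho)+S(\mathcal N(\rho))-S((\mathcal N\otimes\mathcal I)(\psi_\rho))\big],$$ the maximum being over the density matrices $\rho$ on $\mathbb C^2$ and the purifications $\psi_\rho$ of $\rho$ on $\mathbb C^2\otimes\mathbb C^2$. A CQ channel is a map $\rho\mapsto\sum_{m\in\{0,1\}}\langle\psi_m|\rho|\psi_m\rangle\,\sigma_m$ with $\{|\psi_0\rangle,|\psi_1\rangle\}$ an orthonormal basis of $\mathbb C^2$ and $\sigma_0,\sigma_1$ density matrices. A random mixture of maps $\mathcal M_1,\dots,\mathcal M_K$ is a map $\sum_{j=1}^K q_j\mathcal M_j$ with $q_j\ge 0$ and $\sum_j q_j=1$.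 A quantum NOT channel is a random mixture, with all weights positive, of finitely many CQ channels of the form $$\rho\mapsto|\psi_1\rangle\langle\psi_1|\,\langle\psi_0|\rho|\psi_0\rangle+|\psi_0\rangle\langle\psi_0|\,\langle\psi_1|\rho|\psi_1\rangle$$ with $\{|\psi_0\rangle,|\psi_1\rangle\}$ an orthonormal basis, in which at least two of the bases correspond to incompatible observables, i.e. their projectors $|\psi_m\rangle\langle\psi_m|$ do not all commute. **Proposition (failure of a noisy Ruskai theorem).** Let $\mathcal N$ be a quantum NOT channel. 1. If $\mathcal N=\sum_{j=1}^K q_j\mathcal M_j$ is any random mixture of CQ channels $\mathcal M_j$, then $C_{\rm E}(\mathcal M_j)=1$ for every $j$ with $q_j>0$. 2. $\mathcal N$ is an entanglement-breaking channel with $C_{\rm E}(\mathcal N)<1$, and it is not a random mixture of CQ channels in which every channel of positive weight has $C_{\rm E}<1$. Moreover, quantum NOT channels exist. Hence there are entanglement-breaking qubit channels with $C_{\rm E}<1$ that are not random mixtures of CQ channels with $C_{\rm E}<1$. (In all the capacities asserted here the maximum is attained.) -/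

import Mathlib

open scoped Kronecker ComplexOrder

noncomputable section

namespace QInfo

/-- Operators on the Hilbert space with orthonormal basis indexed by `n`. -/
abbrev Op (n : Type*) : Type _ := Matrix n n ℂ

/-- Linear maps (superoperators) on `L(ℂⁿ)`. -/
abbrev SuperOp (n : Type*) : Type _ := Op n →ₗ[ℂ] Op n

/-- The rank-one operator `|v⟩⟨v|`. -/
def ketbra {n : Type*} (v : n → ℂ) : Op n := Matrix.vecMulVec v (star v)

/-- The map `N ⊗ id` on `L(ℂⁿ ⊗ ℂ^κ)`: it applies `N` to every `κ`-block. -/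
def tensorId {n : Type*} (κ : Type*) (N : SuperOp n) : SuperOp (n × κ) where
  toFun X := Matrix.of fun p q =>
    N (Matrix.of fun i j => X (i, p.2) (j, q.2)) p.1 q.1
  map_add' X Y := by
    ext p q
    have h := map_add N (Matrix.of fun i j => X (i, p.2) (j, q.2))
      (Matrix.of fun i j => Y (i, p.2) (j, q.2))
    exact congrFun (congrFun h p.1) q.1
  map_smul' c X := by
    ext p q
    have h := map_smul N c (Matrix.of fun i j => X (i, p.2) (j, q.2))
    exact congrFun (congrFun h p.1) q.1

/-- Density matrices. -/
def IsDensity {n : Type*} [Fintype n] (ρ : Op n) : Prop := ρ.PosSemidef ∧ ρ.trace = 1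

/-- Quantum channels: completely positive trace-preserving maps. -/
def IsChannel {n : Type*} [Fintype n] (N : SuperOp n) : Prop :=
  (∀ (k : ℕ) (X : Op (n × Fin k)), X.PosSemidef → (tensorId (Fin k) N X).PosSemidef) ∧
  ∀ X : Op n, (N X).trace = X.trace

/-- Separable bipartite states: convex combinations of product states. -/
def IsSeparable {n κ : Type*} [Fintype n] [Fintype κ] (τ : Op (n × κ)) : Prop :=
  ∃ (K : ℕ) (p : Fin K → ℝ) (α : Fin K → Op n) (β : Fin K → Op κ),
    (∀ i, 0 ≤ p i) ∧ ∑ i, p i = 1 ∧ (∀ i, IsDensity (α i)) ∧ (∀ i, IsDensity (β i)) ∧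
    τ = ∑ i, (p i : ℂ) • (α i ⊗ₖ β i)

/-- Entanglement-breaking channels: `(N ⊗ id)(|Ψ⟩⟨Ψ|)` is separable for every bipartite pure
state `|Ψ⟩`, with a reference system of any finite dimension. -/
def IsEntanglementBreaking {n : Type*} [Fintype n] (N : SuperOp n) : Prop :=
  IsChannel N ∧ ∀ (k : ℕ) (Ψ : n × Fin k → ℂ), IsDensity (ketbra Ψ) →
    IsSeparable (tensorId (Fin k) N (ketbra Ψ))

/-- Von Neumann entropy `-Tr (σ log₂ σ)`, in bits. -/
def vonNeumannEntropy {n : Type*} [Fintype n] [DecidableEq n] (σ : Op n) : ℝ :=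
  -(σ * cfc (Real.logb 2) σ).trace.re

/-- Partial trace over the second tensor factor. -/
def ptraceRight {n κ : Type*} [Fintype κ] (X : Op (n × κ)) : Op n :=
  Matrix.of fun i j => ∑ a, X (i, a) (j, a)

/-- All values `S(ρ) + S(N(ρ)) - S((N ⊗ id)(ψ_ρ))`, where `ρ` is a density matrix and
`ψ_ρ = |Ψ⟩⟨Ψ|` is a purification of `ρ` on two copies of the system. -/
def mutualInfoValues {n : Type*} [Fintype n] [DecidableEq n] (N : SuperOp n) : Set ℝ :=
  {x | ∃ (ρ : Op n) (Ψ : n × n → ℂ), IsDensity ρ ∧ ptraceRight (ketbra Ψ) = ρ ∧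
    x = vonNeumannEntropy ρ + vonNeumannEntropy (N ρ)
      - vonNeumannEntropy (tensorId n N (ketbra Ψ))}

/-- The entanglement-assisted classical capacity `C_E(N)`, in bits. -/
def eaCapacity {n : Type*} [Fintype n] [DecidableEq n] (N : SuperOp n) : ℝ := sSup (mutualInfoValues N)

/-- `N = ∑ j, q j • M j` is a random mixture of the maps `M j` with probabilities `q j`. -/
def IsMixture {n : Type*} {K : ℕ} (q : Fin K → ℝ) (M : Fin K → SuperOp n) (N : SuperOp n) : Prop :=
  (∀ j, 0 ≤ q j) ∧ ∑ j, q j = 1 ∧ N = ∑ j, (q j : ℂ) • M j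

/-- Orthonormal bases `{|ψ₀⟩, |ψ₁⟩}` of `ℂ²`. -/
abbrev QubitBasis : Type := OrthonormalBasis (Fin 2) ℂ (EuclideanSpace ℂ (Fin 2))

/-- The projector `|ψₘ⟩⟨ψₘ|`. -/
def basisProj (ψ : QubitBasis) (m : Fin 2) : Op (Fin 2) := ketbra (ψ m).ofLp

/-- The map `ρ ↦ ∑ m, ⟨ψₘ|ρ|ψₘ⟩ σₘ`. -/
def cqMap (ψ : QubitBasis) (σ : Fin 2 → Op (Fin 2)) : SuperOp (Fin 2) where
  toFun ρ := ∑ m, (star (ψ m).ofLp ⬝ᵥ Matrix.mulVec ρ (ψ m).ofLp) • σ m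
  map_add' ρ τ := by
    simp only [Matrix.add_mulVec, dotProduct_add, add_smul, Finset.sum_add_distrib]
  map_smul' c ρ := by
    simp only [Matrix.smul_mulVec, dotProduct_smul, smul_assoc, Finset.smul_sum,
      RingHom.id_apply]

/-- Classical-to-quantum (CQ) qubit channels: measure an orthonormal basis and prepare a
state that depends on the outcome. -/
def IsCQChannel (M : SuperOp (Fin 2)) : Prop :=
  ∃ (ψ : QubitBasis) (σ : Fin 2 → Op (Fin 2)), (∀ m, IsDensity (σ m)) ∧ M = cqMap ψ σ

/-- The CQ channel `ρ ↦ ∑ m, ⟨ψₘ|ρ|ψₘ⟩ |ψₘ₊₁⟩⟨ψₘ₊₁|` (index modulo 2) that measures a basis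
and prepares the orthogonal basis state. -/
def cqNot (ψ : QubitBasis) : SuperOp (Fin 2) := cqMap ψ fun m => basisProj ψ (m + 1)

/-- Two bases correspond to incompatible observables if their projectors do not all commute. -/
def Incompatible (ψ φ : QubitBasis) : Prop :=
  ∃ m l : Fin 2, ¬ Commute (basisProj ψ m) (basisProj φ l)

/-- Quantum NOT channels: random mixtures, with positive weights, of channels `cqNot ψ`, in
which at least two bases correspond to incompatible observables. -/
def IsQuantumNOT (N : SuperOp (Fin 2)) : Prop :=
  ∃ (K : ℕ) (q : Fin K → ℝ) (ψ : Fin K → QubitBasis),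
    (∀ j, 0 < q j) ∧ IsMixture q (fun j => cqNot (ψ j)) N ∧
    ∃ i j, Incompatible (ψ i) (ψ j)

/-- `N` is a random mixture of CQ channels of capacity `C_E < 1`. -/
def IsNoisyCQMixture (N : SuperOp (Fin 2)) : Prop :=
  ∃ (K : ℕ) (q : Fin K → ℝ) (M : Fin K → SuperOp (Fin 2)),
    (∀ j, IsCQChannel (M j)) ∧ IsMixture q M N ∧ ∀ j, 0 < q j → eaCapacity (M j) < 1

end QInfo

end

open scoped Kronecker ComplexOrder

noncomputable section

namespace QInfo

open Matrix

/-! ### Von Neumann entropy through eigenvalues: continuity and extremal cases. -/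

section Entropy

variable {n κ : Type*} [Fintype n] [DecidableEq n] [Fintype κ] [DecidableEq κ]

/-! The trace of a superoperator rules out every other CQ decomposition. For the CQ channel that
measures `ψ` and prepares `σ m` it equals `∑ m, ⟨ψₘ|σₘ|ψₘ⟩ ≥ 0`, and it vanishes on each `cqNot ψ`,
hence on every quantum NOT channel. Nothing can cancel in a mixture, so each CQ component of
positive weight has trace zero, which forces it to be some `cqNot ψ`
(`IsQuantumNOT.exists_eq_cqNot`).

A separable state is dominated by marginal ⊗ 1 (the reduction criterion), so its entropy is at least
that of the marginal (`vonNeumannEntropy_ptraceRight_le`). For an entanglement-breaking qubit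
channel every mutual information value is therefore at most `S(ρ) ≤ 1`. A maximally entangled input
attains 1 for `cqNot ψ`, because the output is half a rank-two projector.

For a quantum NOT channel the value 1 would force `ρ = 1/2`. The output `τ` then satisfies `τ ≤ 1/2`
by reduction and `S(τ) ≤ 1`, so `τ² = τ/2`. The outputs of the components satisfy the same equation,
and strict convexity of the Hilbert-Schmidt norm makes all of them equal to `τ`. A maximally
entangled input determines the channel, so all the components `cqNot (ψ j)` coincide, against
incompatibility. Since the entropy is continuous and the unit vectors form a compact set, the
maximum is attained, and the capacity itself is below 1. -/

theorem trace_cfc {σ : Op n} (hσ : σ.IsHermitian) (f : ℝ → ℝ) :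
    (cfc f σ).trace = ∑ i, (f (hσ.eigenvalues i) : ℂ) := by
  rw [hσ.cfc_eq, IsHermitian.cfc, Unitary.conjStarAlgAut_apply, trace_mul_cycle,
    Unitary.coe_star_mul_self, one_mul, trace_diagonal]
  rfl

/-- Unlike the logarithm, `Real.negMulLog` is continuous at 0, so this form gives continuity of the
entropy at singular states too. -/
theorem vonNeumannEntropy_eq_cfc {σ : Op n} (hσ : σ.IsHermitian) :
    vonNeumannEntropy σ = (cfc Real.negMulLog σ).trace.re / Real.log 2 := by
  have hf : ContinuousOn (Real.logb 2) (spectrum ℝ σ) :=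
    (Matrix.finite_real_spectrum (A := σ)).continuousOn _
  have hid : ContinuousOn (fun x : ℝ => x) (spectrum ℝ σ) := continuousOn_id
  have h : σ * cfc (Real.logb 2) σ = cfc (fun x : ℝ => x * Real.logb 2 x) σ := by
    rw [cfc_mul (fun x : ℝ => x) (Real.logb 2) σ hid hf, cfc_id' ℝ σ hσ.isSelfAdjoint]
  rw [vonNeumannEntropy, h, trace_cfc hσ, trace_cfc hσ, ← Complex.ofReal_sum,
    ← Complex.ofReal_sum, Complex.ofReal_re, Complex.ofReal_re, Finset.sum_div,
    ← Finset.sum_neg_distrib]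
  refine Finset.sum_congr rfl fun i _ => ?_
  rw [Real.negMulLog, Real.logb]
  ring

theorem vonNeumannEntropy_eq_sum {σ : Op n} (hσ : σ.IsHermitian) :
    vonNeumannEntropy σ = (∑ i, Real.negMulLog (hσ.eigenvalues i)) / Real.log 2 := by
  rw [vonNeumannEntropy_eq_cfc hσ, trace_cfc hσ, ← Complex.ofReal_sum, Complex.ofReal_re]

theorem IsDensity.isHermitian {m : Type*} [Fintype m] {σ : Op m} (hσ : IsDensity σ) : σ.IsHermitian := hσ.1.isHermitian

theorem IsDensity.sum_eigenvalues {σ : Op n} (hσ : IsDensity σ) :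
    ∑ i, hσ.isHermitian.eigenvalues i = 1 := by
  have h := hσ.isHermitian.trace_eq_sum_eigenvalues
  rw [hσ.2] at h
  refine Complex.ofReal_injective ?_
  rw [Complex.ofReal_sum, Complex.ofReal_one]
  exact h.symm

theorem IsDensity.eigenvalues_le_one {σ : Op n} (hσ : IsDensity σ) (i : n) :
    hσ.isHermitian.eigenvalues i ≤ 1 := by
  rw [← hσ.sum_eigenvalues]
  exact Finset.single_le_sum (fun j _ => hσ.1.eigenvalues_nonneg j) (Finset.mem_univ i)

theorem spectrum_subset_Icc_of_isDensity {σ : Op n} (hσ : IsDensity σ) :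
    spectrum ℝ σ ⊆ Set.Icc 0 1 := by
  rw [hσ.isHermitian.spectrum_real_eq_range_eigenvalues]
  rintro _ ⟨i, rfl⟩
  exact ⟨hσ.1.eigenvalues_nonneg i, hσ.eigenvalues_le_one i⟩

open scoped Matrix.Norms.L2Operator in
-- The functional calculus varies continuously with the operator because all the spectra lie in the
-- fixed compact set `[0, 1]`.
theorem continuousOn_cfc_negMulLog {X : Type*} [TopologicalSpace X] {a : X → Op n} {t : Set X}
    (ha : ContinuousOn a t) (h : ∀ x ∈ t, IsDensity (a x)) :
    ContinuousOn (fun x => cfc Real.negMulLog (a x)) t :=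
  ContinuousOn.cfc' (isCompact_Icc (a := (0 : ℝ)) (b := 1)) Real.negMulLog ha
    (fun x hx => spectrum_subset_Icc_of_isDensity (h x hx))
    (hf := Real.continuous_negMulLog.continuousOn) (ha' := fun x hx => (h x hx).isHermitian)

/-- The von Neumann entropy is continuous on density matrices. -/
theorem continuousOn_vonNeumannEntropy {X : Type*} [TopologicalSpace X] {a : X → Op n} {t : Set X}
    (ha : ContinuousOn a t) (h : ∀ x ∈ t, IsDensity (a x)) :
    ContinuousOn (fun x => vonNeumannEntropy (a x)) t := by
  have hc := continuousOn_cfc_negMulLog ha h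
  have htr : Continuous fun A : Op n => A.trace.re / Real.log 2 := by
    have : Continuous fun A : Op n => A.trace := continuous_id.matrix_trace
    fun_prop
  exact (htr.comp_continuousOn hc).congr fun x hx => vonNeumannEntropy_eq_cfc (h x hx).isHermitian

/-- Averaging `log (l i / a j) ≤ l i / a j - 1` over `j` with weights `w i j` gives `log (l i) ≤ ∑
j, w i j * log (a j)`, by `hle`; then multiply by `l i` and sum. In the application `l` is the
spectrum of a state, `a` that of its marginal, and `hle` encodes the reduction criterion. -/
theorem sum_negMulLog_le_of_weights {ι μ : Type*} [Fintype ι] [Fintype μ] {l : ι → ℝ} {a : μ → ℝ}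
    {w : ι → μ → ℝ} (hl : ∀ i, 0 ≤ l i) (ha : ∀ j, 0 ≤ a j) (hw : ∀ i j, 0 ≤ w i j)
    (hrow : ∀ i, ∑ j, w i j = 1) (hcol : ∀ j, ∑ i, l i * w i j = a j)
    (hle : ∀ i, l i * ∑ j, w i j / a j ≤ 1) :
    ∑ j, Real.negMulLog (a j) ≤ ∑ i, Real.negMulLog (l i) := by
  have key : ∀ i, l i * Real.log (l i) ≤ l i * ∑ j, w i j * Real.log (a j) := by
    intro i
    rcases (hl i).eq_or_lt with h0 | hpos
    · simp [← h0]
    refine mul_le_mul_of_nonneg_left ?_ (hl i)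
    -- Where `a j = 0` the weight vanishes too, so the default values of `log 0` and of division by
    -- zero do no harm.
    have hz : ∀ j, a j = 0 → w i j = 0 := by
      intro j hj
      have hs := hcol j
      rw [hj, Finset.sum_eq_zero_iff_of_nonneg fun k _ => mul_nonneg (hl k) (hw k j)] at hs
      simpa [hpos.ne'] using hs i (Finset.mem_univ i)
    have hterm : ∀ j, w i j * Real.log (l i) - w i j * Real.log (a j)
        ≤ l i * (w i j / a j) - w i j := by
      intro j
      rcases (ha j).eq_or_lt with h0 | hj
      · simp [hz j h0.symm]
      have h1 := Real.log_le_sub_one_of_pos (div_pos hpos hj)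
      rw [Real.log_div hpos.ne' hj.ne'] at h1
      calc _ = w i j * (Real.log (l i) - Real.log (a j)) := by ring
        _ ≤ w i j * (l i / a j - 1) := mul_le_mul_of_nonneg_left h1 (hw i j)
        _ = _ := by ring
    have hsum := Finset.sum_le_sum fun j (_ : j ∈ Finset.univ) => hterm j
    rw [Finset.sum_sub_distrib, Finset.sum_sub_distrib, ← Finset.sum_mul, ← Finset.mul_sum,
      hrow i, one_mul] at hsum
    linarith [hle i]
  have h2 := Finset.sum_le_sum fun i (_ : i ∈ Finset.univ) => key i
  have h3 : ∑ i, l i * ∑ j, w i j * Real.log (a j) = ∑ j, a j * Real.log (a j) := by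
    simp_rw [Finset.mul_sum]
    rw [Finset.sum_comm]
    refine Finset.sum_congr rfl fun j _ => ?_
    rw [← hcol j, Finset.sum_mul]
    exact Finset.sum_congr rfl fun i _ => by ring
  rw [h3] at h2
  simp only [Real.negMulLog, neg_mul, Finset.sum_neg_distrib]
  linarith

theorem eigenvalue_sq_of_mul_self {σ : Op n} (hσ : σ.IsHermitian) (h : σ * σ = (1 / 2 : ℂ) • σ)
    (i : n) : hσ.eigenvalues i * hσ.eigenvalues i = hσ.eigenvalues i / 2 := by
  have h1 := hσ.mulVec_eigenvectorBasis i
  have h2 : (σ * σ) *ᵥ (hσ.eigenvectorBasis i).ofLp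
      = ((1 / 2 : ℂ) • σ) *ᵥ (hσ.eigenvectorBasis i).ofLp := by rw [h]
  rw [← mulVec_mulVec, smul_mulVec, h1, mulVec_smul, h1] at h2
  have hne : (hσ.eigenvectorBasis i).ofLp ≠ 0 := by
    intro h0
    exact hσ.eigenvectorBasis.orthonormal.ne_zero i (by ext k; exact congrFun h0 k)
  obtain ⟨k, hk⟩ := Function.ne_iff.mp hne
  have h3 := congrFun h2 k
  simp only [Pi.smul_apply, smul_eq_mul, Complex.real_smul] at h3
  have h4 : ((hσ.eigenvalues i : ℂ) * hσ.eigenvalues i) = (hσ.eigenvalues i : ℂ) / 2 := by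
    refine mul_right_cancel₀ hk ?_
    linear_combination h3
  exact_mod_cast h4

theorem negMulLog_two_inv : Real.negMulLog 2⁻¹ = 2⁻¹ * Real.log 2 := by
  rw [Real.negMulLog, Real.log_inv]; ring

/-- A state proportional to a projector of rank two has one bit of entropy. -/
theorem vonNeumannEntropy_eq_one {σ : Op n} (hσ : IsDensity σ) (h : σ * σ = (1 / 2 : ℂ) • σ) :
    vonNeumannEntropy σ = 1 := by
  have hlog : Real.log 2 ≠ 0 := (Real.log_pos one_lt_two).ne'
  rw [vonNeumannEntropy_eq_sum hσ.isHermitian, div_eq_one_iff_eq hlog,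
    ← one_mul (Real.log 2), ← hσ.sum_eigenvalues, Finset.sum_mul]
  refine Finset.sum_congr rfl fun i _ => ?_
  have h1 := eigenvalue_sq_of_mul_self hσ.isHermitian h i
  have h2 : hσ.isHermitian.eigenvalues i * (hσ.isHermitian.eigenvalues i - 2⁻¹) = 0 := by
    linear_combination h1
  rcases mul_eq_zero.mp h2 with h0 | h0
  · simp [h0]
  · rw [sub_eq_zero.mp h0, negMulLog_two_inv]

/-- A state all of whose eigenvalues are at most `1/2` and that has at most one bit of entropy is
proportional to a projector of rank two. -/
theorem mul_self_eq_of_entropy_le_one {σ : Op n} (hσ : IsDensity σ)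
    (hle : ∀ i, hσ.isHermitian.eigenvalues i ≤ 2⁻¹) (hS : vonNeumannEntropy σ ≤ 1) :
    σ * σ = (1 / 2 : ℂ) • σ := by
  have hlog : 0 < Real.log 2 := Real.log_pos one_lt_two
  have hnn := hσ.1.eigenvalues_nonneg
  -- The left sides add up to `log 2`, which the entropy does not exceed. So equality holds in every
  -- term, and each eigenvalue is 0 or 1/2.
  have hterm : ∀ i, hσ.isHermitian.eigenvalues i * Real.log 2
      ≤ Real.negMulLog (hσ.isHermitian.eigenvalues i) := by
    intro i
    rcases (hnn i).eq_or_lt with h0 | hpos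
    · simp [← h0]
    have := Real.log_le_log hpos (hle i)
    rw [Real.log_inv] at this
    rw [Real.negMulLog]
    nlinarith
  have hsum : ∑ i, hσ.isHermitian.eigenvalues i * Real.log 2
      = ∑ i, Real.negMulLog (hσ.isHermitian.eigenvalues i) := by
    refine le_antisymm (Finset.sum_le_sum fun i _ => hterm i) ?_
    rw [← Finset.sum_mul, hσ.sum_eigenvalues, one_mul]
    rw [vonNeumannEntropy_eq_sum hσ.isHermitian, div_le_one hlog] at hS
    exact hS
  have heq := (Finset.sum_eq_sum_iff_of_le fun i _ => hterm i).mp hsum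
  have hsq : ∀ i, hσ.isHermitian.eigenvalues i * hσ.isHermitian.eigenvalues i
      = 2⁻¹ * hσ.isHermitian.eigenvalues i := by
    intro i
    rcases (hnn i).eq_or_lt with h0 | hpos
    · simp [← h0]
    have h1 := heq i (Finset.mem_univ i)
    have h2 : Real.log (hσ.isHermitian.eigenvalues i) = Real.log 2⁻¹ := by
      rw [Real.log_inv]
      refine mul_left_cancel₀ hpos.ne' ?_
      rw [Real.negMulLog] at h1
      linarith
    rw [Real.log_injOn_pos (Set.mem_Ioi.mpr hpos) (Set.mem_Ioi.mpr (by norm_num)) h2]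
  have hsp := hσ.isHermitian.spectral_theorem
  rw [hsp, ← map_mul, diagonal_mul_diagonal, ← map_smul, ← diagonal_smul]
  congr 2
  ext i
  have := hsq i
  simp only [Function.comp_apply, Pi.smul_apply, smul_eq_mul]
  have h4 : ((hσ.isHermitian.eigenvalues i : ℂ) * hσ.isHermitian.eigenvalues i)
    = 2⁻¹ * (hσ.isHermitian.eigenvalues i : ℂ) := by
    rw [← Complex.ofReal_mul, this]; push_cast; rfl
  rw [one_div]
  exact h4

theorem eigenvalues_le_of_posSemidef {σ : Op n} (hσ : σ.IsHermitian) {c : ℝ}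
    (h : ((c : ℂ) • (1 : Op n) - σ).PosSemidef) (i : n) : hσ.eigenvalues i ≤ c := by
  have h1 := h.re_dotProduct_nonneg (hσ.eigenvectorBasis i).ofLp
  have hn : star (hσ.eigenvectorBasis i).ofLp ⬝ᵥ (hσ.eigenvectorBasis i).ofLp = 1 := by
    have := (orthonormal_iff_ite.mp hσ.eigenvectorBasis.orthonormal) i i
    rw [if_pos rfl, EuclideanSpace.inner_eq_star_dotProduct, dotProduct_comm] at this
    exact this
  rw [sub_mulVec, smul_mulVec, one_mulVec, hσ.mulVec_eigenvectorBasis, dotProduct_sub,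
    dotProduct_smul, dotProduct_smul, hn] at h1
  simp at h1
  exact h1

theorem qubit_entropy_eq_binEntropy {ρ : Op (Fin 2)} (hρ : IsDensity ρ) :
    vonNeumannEntropy ρ = Real.binEntropy (hρ.isHermitian.eigenvalues 0) / Real.log 2 := by
  have h := hρ.sum_eigenvalues
  rw [Fin.sum_univ_two] at h
  rw [vonNeumannEntropy_eq_sum hρ.isHermitian, Fin.sum_univ_two,
    Real.binEntropy_eq_negMulLog_add_negMulLog_one_sub, ← eq_sub_iff_add_eq'.mpr h]

theorem qubit_entropy_le_one {ρ : Op (Fin 2)} (hρ : IsDensity ρ) : vonNeumannEntropy ρ ≤ 1 := by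
  rw [qubit_entropy_eq_binEntropy hρ, div_le_one (Real.log_pos one_lt_two)]
  exact Real.binEntropy_le_log_two

theorem qubit_eq_of_one_le_entropy {ρ : Op (Fin 2)} (hρ : IsDensity ρ)
    (h : 1 ≤ vonNeumannEntropy ρ) : ρ = (1 / 2 : ℂ) • 1 := by
  rw [qubit_entropy_eq_binEntropy hρ, one_le_div (Real.log_pos one_lt_two)] at h
  have h0 : hρ.isHermitian.eigenvalues 0 = 2⁻¹ := by
    by_contra hne
    exact absurd (Real.binEntropy_lt_log_two.mpr hne) (not_lt.mpr h)
  have h1 : hρ.isHermitian.eigenvalues 1 = 2⁻¹ := by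
    have := hρ.sum_eigenvalues
    rw [Fin.sum_univ_two, h0] at this
    linarith
  have hd : (diagonal (RCLike.ofReal ∘ hρ.isHermitian.eigenvalues) : Op (Fin 2))
      = (1 / 2 : ℂ) • 1 := by
    rw [smul_one_eq_diagonal]
    congr 1
    ext i
    fin_cases i <;> simp [h0, h1]
  rw [hρ.isHermitian.spectral_theorem, hd, map_smul, map_one]

end Entropy

/-! ### The reduction criterion bounds the entropy of a marginal. -/

section Reduction

variable {n κ : Type*} [Fintype n] [DecidableEq n] [Fintype κ] [DecidableEq κ]

theorem ptraceRight_conj {n : Type*} [Fintype n] (U : Op n) (X : Op (n × κ)) :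
    ptraceRight ((U ⊗ₖ (1 : Op κ)) * X * (U ⊗ₖ (1 : Op κ))ᴴ) = U * ptraceRight X * Uᴴ := by
  ext i j
  simp only [ptraceRight, of_apply, mul_apply, conjTranspose_apply, kroneckerMap_apply,
    Fintype.sum_prod_type, one_apply, mul_ite, mul_one, mul_zero, ite_mul, zero_mul,
    Finset.sum_ite_eq, Finset.mem_univ, if_true, apply_ite star, star_zero, Finset.sum_mul,
    Finset.mul_sum]
  rw [Finset.sum_comm]
  refine Finset.sum_congr rfl fun k _ => ?_
  rw [Finset.sum_comm]

/-- Test positivity on `D⁻¹z`, with `D = diag a` (pseudo-inverted) and `z` the `i`-th column of `Z`.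
Writing `x = ⟨z, D⁻¹z⟩` and keeping only the `i`-th term of the subtracted sum gives `l i * x² ≤ x`.
-/
theorem weight_bound {μ : Type*} [Fintype μ] [DecidableEq μ] {l a : μ → ℝ} {Z : Op μ}
    (hl : ∀ i, 0 ≤ l i)
    (h : (diagonal (fun p => (a p : ℂ)) - Z * diagonal (fun p => (l p : ℂ)) * Zᴴ).PosSemidef)
    (i : μ) : l i * ∑ p, ‖Z p i‖ ^ 2 / a p ≤ 1 := by
  set x := ∑ p, ‖Z p i‖ ^ 2 / a p with hx
  have hquad : l i * x ^ 2 ≤ x := by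
    have h1 := h.re_dotProduct_nonneg fun p => Z p i / a p
    have e1 : star (fun p => Z p i / a p) ⬝ᵥ (diagonal (fun p => (a p : ℂ)) *ᵥ
        fun p => Z p i / a p) = (x : ℂ) := by
      rw [hx, Complex.ofReal_sum, dotProduct]
      refine Finset.sum_congr rfl fun p _ => ?_
      rw [mulVec_diagonal]
      by_cases h0 : a p = 0
      · simp [h0]
      have h0' : (a p : ℂ) ≠ 0 := by exact_mod_cast h0
      simp only [Pi.star_apply, star_div₀, Complex.star_def, Complex.conj_ofReal,
        Complex.ofReal_div, Complex.ofReal_pow, ← Complex.conj_mul']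
      field_simp
    have e2 : star (fun p => Z p i / a p) ⬝ᵥ ((Z * diagonal (fun p => (l p : ℂ)) * Zᴴ) *ᵥ
        fun p => Z p i / a p)
        = ((∑ k, l k * ‖(Zᴴ *ᵥ fun p => Z p i / a p) k‖ ^ 2 : ℝ) : ℂ) := by
      rw [← mulVec_mulVec, ← mulVec_mulVec, dotProduct_mulVec, ← conjTranspose_conjTranspose Z,
        ← star_mulVec, conjTranspose_conjTranspose,
        Complex.ofReal_sum, dotProduct]
      refine Finset.sum_congr rfl fun k _ => ?_
      rw [mulVec_diagonal]
      simp only [Pi.star_apply, Complex.star_def, Complex.ofReal_mul, Complex.ofReal_pow,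
        ← Complex.conj_mul']
      ring
    have e3 : (Zᴴ *ᵥ fun p => Z p i / a p) i = (x : ℂ) := by
      rw [hx, Complex.ofReal_sum, mulVec, dotProduct]
      refine Finset.sum_congr rfl fun p _ => ?_
      simp only [conjTranspose_apply, Complex.star_def, Complex.ofReal_div, Complex.ofReal_pow,
        ← Complex.conj_mul']
      ring
    rw [sub_mulVec, dotProduct_sub, e1, e2, ← Complex.ofReal_sub] at h1
    have h2 : l i * ‖(Zᴴ *ᵥ fun p => Z p i / a p) i‖ ^ 2
        ≤ ∑ k, l k * ‖(Zᴴ *ᵥ fun p => Z p i / a p) k‖ ^ 2 :=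
      Finset.single_le_sum (f := fun k => l k * ‖(Zᴴ *ᵥ fun p => Z p i / a p) k‖ ^ 2)
        (fun k _ => mul_nonneg (hl k) (sq_nonneg _)) (Finset.mem_univ i)
    rw [e3, Complex.norm_real, Real.norm_eq_abs, sq_abs] at h2
    have h3 : (0 : ℝ) ≤ x - ∑ k, l k * ‖(Zᴴ *ᵥ fun p => Z p i / a p) k‖ ^ 2 := h1
    linarith
  rcases le_or_gt x 0 with h0 | h0
  · nlinarith [hl i]
  · nlinarith [hl i]

theorem sum_norm_sq_col_of_mem_unitaryGroup {μ : Type*} [Fintype μ] [DecidableEq μ] {Z : Op μ}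
    (hZ : Zᴴ * Z = 1) (i : μ) : ∑ p, ‖Z p i‖ ^ 2 = 1 := by
  have h := congrFun (congrFun hZ i) i
  rw [mul_apply, one_apply_eq] at h
  refine Complex.ofReal_injective ?_
  rw [Complex.ofReal_sum, Complex.ofReal_one, ← h]
  refine Finset.sum_congr rfl fun p _ => ?_
  rw [conjTranspose_apply, Complex.star_def, Complex.ofReal_pow, Complex.conj_mul']

theorem conj_diagonal_apply_self {μ : Type*} [Fintype μ] [DecidableEq μ] (Z : Op μ) (l : μ → ℝ)
    (p : μ) : (Z * diagonal (fun p => (l p : ℂ)) * Zᴴ) p p = ((∑ i, l i * ‖Z p i‖ ^ 2 : ℝ) : ℂ) := by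
  rw [mul_apply, Complex.ofReal_sum]
  refine Finset.sum_congr rfl fun i _ => ?_
  rw [mul_diagonal, conjTranspose_apply, Complex.star_def, Complex.ofReal_mul, Complex.ofReal_pow,
    ← Complex.conj_mul']
  ring

theorem spectral_conj {σ : Op n} (hσ : σ.IsHermitian) :
    σ = (hσ.eigenvectorUnitary : Op n) * diagonal (fun i => (hσ.eigenvalues i : ℂ)) *
      (hσ.eigenvectorUnitary : Op n)ᴴ :=
  hσ.spectral_theorem

/-- A state that satisfies the reduction criterion has at least the entropy of its marginal. -/
theorem vonNeumannEntropy_ptraceRight_le {τ : Op (n × κ)} (hτ : τ.PosSemidef)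
    (hA : (ptraceRight τ).PosSemidef) (h : (ptraceRight τ ⊗ₖ (1 : Op κ) - τ).PosSemidef) :
    vonNeumannEntropy (ptraceRight τ) ≤ vonNeumannEntropy τ := by
  set A := ptraceRight τ with hAdef
  have hAh := hA.isHermitian
  have hτh := hτ.isHermitian
  set U : Op n := hAh.eigenvectorUnitary.1
  set V : Op (n × κ) := hτh.eigenvectorUnitary.1
  set a := hAh.eigenvalues
  set l := hτh.eigenvalues
  have hUU : Uᴴ * U = 1 := Unitary.coe_star_mul_self hAh.eigenvectorUnitary
  have hUU' : U * Uᴴ = 1 := Unitary.coe_mul_star_self hAh.eigenvectorUnitary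
  have hVV : Vᴴ * V = 1 := Unitary.coe_star_mul_self hτh.eigenvectorUnitary
  have hAs : A = U * diagonal (fun i => (a i : ℂ)) * Uᴴ := spectral_conj hAh
  have hτs : τ = V * diagonal (fun i => (l i : ℂ)) * Vᴴ := spectral_conj hτh
  have hAd : Uᴴ * A * U = diagonal (fun i => (a i : ℂ)) := by
    rw [hAs, show Uᴴ * (U * diagonal (fun i => (a i : ℂ)) * Uᴴ) * U
      = (Uᴴ * U) * diagonal (fun i => (a i : ℂ)) * (Uᴴ * U) by simp only [mul_assoc], hUU,
      one_mul, mul_one]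
  -- `W` passes to the eigenbasis of the marginal in the first factor, where the marginal is
  -- diagonal; the columns of `Z` are the eigenvectors of `τ` in these coordinates.
  set W : Op (n × κ) := Uᴴ ⊗ₖ (1 : Op κ) with hW
  have hWH : Wᴴ = U ⊗ₖ (1 : Op κ) := by
    rw [hW, conjTranspose_kronecker, conjTranspose_one, conjTranspose_conjTranspose]
  have hWW : Wᴴ * W = 1 := by
    rw [hWH, hW, ← mul_kronecker_mul, hUU', one_mul, one_kronecker_one]
  set Z : Op (n × κ) := W * V with hZ
  have hZZ : Zᴴ * Z = 1 := by
    rw [hZ, conjTranspose_mul, mul_assoc, ← mul_assoc Wᴴ, hWW, one_mul, hVV]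
  have hconj : W * τ * Wᴴ = Z * diagonal (fun i => (l i : ℂ)) * Zᴴ := by
    rw [hτs, hZ, conjTranspose_mul]
    simp only [mul_assoc]
  have hmarg : ptraceRight (Z * diagonal (fun i => (l i : ℂ)) * Zᴴ)
      = diagonal (fun i => (a i : ℂ)) := by
    rw [← hconj, hW, ptraceRight_conj, conjTranspose_conjTranspose, ← hAdef, hAd]
  have hred : (diagonal (fun p : n × κ => (a p.1 : ℂ))
      - Z * diagonal (fun i => (l i : ℂ)) * Zᴴ).PosSemidef := by
    have h1 := h.mul_mul_conjTranspose_same W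
    rw [mul_sub, sub_mul, hconj] at h1
    convert h1 using 2
    rw [hWH, hW, ← mul_kronecker_mul, ← mul_kronecker_mul, hAd, one_mul, one_mul,
      ← diagonal_one, diagonal_kronecker_diagonal]
    simp
  rw [vonNeumannEntropy_eq_sum hAh, vonNeumannEntropy_eq_sum hτh]
  refine div_le_div_of_nonneg_right ?_ (Real.log_pos one_lt_two).le
  -- The weight is the probability that the `i`-th eigenvector of `τ` has its first factor in the
  -- `j`-th eigenvector of the marginal.
  refine sum_negMulLog_le_of_weights (w := fun i j => ∑ b, ‖Z (j, b) i‖ ^ 2)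
    hτ.eigenvalues_nonneg hA.eigenvalues_nonneg
    (fun i j => Finset.sum_nonneg fun b _ => sq_nonneg _) (fun i => ?_) (fun j => ?_)
    (fun i => ?_)
  · rw [← Fintype.sum_prod_type']
    exact sum_norm_sq_col_of_mem_unitaryGroup hZZ i
  · have h1 := congrFun (congrFun hmarg j) j
    rw [diagonal_apply_eq, ptraceRight, of_apply] at h1
    simp only [conj_diagonal_apply_self] at h1
    rw [← Complex.ofReal_sum] at h1
    refine Eq.trans ?_ (Complex.ofReal_injective h1)
    rw [Finset.sum_comm]
    exact Finset.sum_congr rfl fun i _ => Finset.mul_sum _ _ _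
  · have h1 := weight_bound hτ.eigenvalues_nonneg hred i
    rw [Fintype.sum_prod_type] at h1
    simp_rw [Finset.sum_div]
    exact h1

end Reduction

/-! ### Rank-one operators and the projectors of a qubit basis. -/

section Kets

theorem ketbra_apply {n : Type*} (v : n → ℂ) (i j : n) : ketbra v i j = v i * star (v j) := rfl

theorem posSemidef_ketbra {n : Type*} [Fintype n] (v : n → ℂ) : (ketbra v).PosSemidef :=
  posSemidef_vecMulVec_self_star v

theorem ketbra_mul_ketbra {n : Type*} [Fintype n] (v w : n → ℂ) :
    ketbra v * ketbra w = (star v ⬝ᵥ w) • vecMulVec v (star w) := by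
  rw [ketbra, ketbra, vecMulVec_mul_vecMulVec, vecMulVec_smul]

theorem trace_ketbra {n : Type*} [Fintype n] (v : n → ℂ) : (ketbra v).trace = star v ⬝ᵥ v := by
  rw [ketbra, trace_vecMulVec, dotProduct_comm]

theorem ketbra_mulVec {n : Type*} [Fintype n] (v w : n → ℂ) :
    ketbra v *ᵥ w = (star v ⬝ᵥ w) • v := by
  rw [ketbra, vecMulVec_mulVec, op_smul_eq_smul]

theorem basis_dotProduct (ψ : QubitBasis) (m l : Fin 2) :
    star (ψ m).ofLp ⬝ᵥ (ψ l).ofLp = if m = l then 1 else 0 := by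
  have h := (orthonormal_iff_ite.mp ψ.orthonormal) m l
  rw [EuclideanSpace.inner_eq_star_dotProduct, dotProduct_comm] at h
  exact h

theorem basis_dotProduct_succ (ψ : QubitBasis) (m : Fin 2) :
    star (ψ m).ofLp ⬝ᵥ (ψ (m + 1)).ofLp = 0 := by
  rw [basis_dotProduct, if_neg]
  fin_cases m <;> decide

theorem basisProj_mul (ψ : QubitBasis) (m l : Fin 2) :
    basisProj ψ m * basisProj ψ l = if m = l then basisProj ψ m else 0 := by
  rw [basisProj, basisProj, ketbra_mul_ketbra, basis_dotProduct]
  split_ifs with h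
  · rw [h, one_smul, ketbra]
  · rw [zero_smul]

theorem isDensity_basisProj (ψ : QubitBasis) (m : Fin 2) : IsDensity (basisProj ψ m) :=
  ⟨posSemidef_ketbra _, by rw [basisProj, trace_ketbra, basis_dotProduct, if_pos rfl]⟩

theorem sum_basisProj (ψ : QubitBasis) : ∑ m, basisProj ψ m = 1 := by
  have h : ∀ v : Fin 2 → ℂ, (∑ m, basisProj ψ m) *ᵥ v = v := by
    intro v
    have h1 := ψ.sum_repr' (WithLp.toLp 2 v)
    have h2 := congrArg WithLp.ofLp h1
    rw [sum_mulVec]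
    refine Eq.trans ?_ h2
    rw [WithLp.ofLp_sum]
    refine Finset.sum_congr rfl fun m _ => ?_
    rw [basisProj, ketbra_mulVec, WithLp.ofLp_smul, EuclideanSpace.inner_eq_star_dotProduct,
      dotProduct_comm]
  refine ext_of_mulVec_single fun i => ?_
  rw [h, one_mulVec]

theorem sum_basisProj_succ (ψ : QubitBasis) : ∑ m, basisProj ψ (m + 1) = 1 := by
  rw [← sum_basisProj ψ, Fin.sum_univ_two, Fin.sum_univ_two, add_comm]
  rfl

theorem basisProj_add_succ (ψ : QubitBasis) (m : Fin 2) :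
    basisProj ψ m + basisProj ψ (m + 1) = 1 := by
  have h := sum_basisProj ψ
  rw [Fin.sum_univ_two] at h
  fin_cases m
  · exact h
  · exact (add_comm _ _).trans h

theorem trace_eq_sum_basis (ψ : QubitBasis) (X : Op (Fin 2)) :
    ∑ m, star (ψ m).ofLp ⬝ᵥ (X *ᵥ (ψ m).ofLp) = X.trace := by
  conv_rhs => rw [← mul_one X, ← sum_basisProj ψ, Finset.mul_sum, trace_sum]
  refine Finset.sum_congr rfl fun m _ => ?_
  rw [basisProj, ketbra, mul_vecMulVec, trace_vecMulVec, dotProduct_comm]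

theorem IsDensity.posSemidef_one_sub {n : Type*} [Fintype n] [DecidableEq n] {β : Op n}
    (hβ : IsDensity β) : (1 - β).PosSemidef := by
  have hs := spectral_conj hβ.isHermitian
  have hVV : hβ.isHermitian.eigenvectorUnitary.1 * (hβ.isHermitian.eigenvectorUnitary.1)ᴴ = 1 :=
    Unitary.coe_mul_star_self hβ.isHermitian.eigenvectorUnitary
  have hd : (diagonal fun i => ((1 - hβ.isHermitian.eigenvalues i : ℝ) : ℂ)).PosSemidef := by
    refine PosSemidef.diagonal fun i => ?_
    exact Complex.zero_le_real.mpr (sub_nonneg.mpr (hβ.eigenvalues_le_one i))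
  convert hd.mul_mul_conjTranspose_same hβ.isHermitian.eigenvectorUnitary.1 using 1
  have he : (diagonal fun i => ((1 - hβ.isHermitian.eigenvalues i : ℝ) : ℂ))
      = 1 - diagonal fun i => (hβ.isHermitian.eigenvalues i : ℂ) := by
    rw [← diagonal_one, diagonal_sub]
    simp
  rw [he, mul_sub, sub_mul, mul_one, hVV, ← hs]

end Kets

/-! ### Partial traces, separable states and the reduction criterion. -/

section Bipartite

variable {n κ : Type*}

theorem ptraceRight_kronecker [Fintype κ] (α : Op n) (β : Op κ) :
    ptraceRight (α ⊗ₖ β) = β.trace • α := by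
  ext i j
  simp only [ptraceRight, of_apply, kroneckerMap_apply, Matrix.smul_apply, smul_eq_mul, trace, diag_apply,
    Finset.sum_mul]
  exact Finset.sum_congr rfl fun a _ => mul_comm _ _

theorem ptraceRight_sum [Fintype κ] {ι : Type*} (s : Finset ι) (X : ι → Op (n × κ)) :
    ptraceRight (∑ i ∈ s, X i) = ∑ i ∈ s, ptraceRight (X i) := by
  ext i j
  simp only [ptraceRight, of_apply, Matrix.sum_apply]
  exact Finset.sum_comm

theorem ptraceRight_smul [Fintype κ] (c : ℂ) (X : Op (n × κ)) :
    ptraceRight (c • X) = c • ptraceRight X := by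
  ext i j
  simp only [ptraceRight, of_apply, Matrix.smul_apply, Finset.smul_sum]

theorem trace_ptraceRight [Fintype n] [Fintype κ] (X : Op (n × κ)) :
    (ptraceRight X).trace = X.trace := by
  simp only [trace, diag_apply, ptraceRight, of_apply, Fintype.sum_prod_type]

theorem ptraceRight_tensorId [Fintype κ] (N : SuperOp n) (X : Op (n × κ)) :
    ptraceRight (tensorId κ N X) = N (ptraceRight X) := by
  have h : ptraceRight X = ∑ a, Matrix.of fun i j => X (i, a) (j, a) := by
    ext i j
    simp only [ptraceRight, of_apply, Matrix.sum_apply]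
  rw [h, map_sum]
  ext i j
  simp only [ptraceRight, of_apply, Matrix.sum_apply]
  rfl

theorem trace_tensorId [Fintype n] [Fintype κ] {N : SuperOp n}
    (hN : ∀ X : Op n, (N X).trace = X.trace) (X : Op (n × κ)) :
    (tensorId κ N X).trace = X.trace := by
  rw [← trace_ptraceRight, ptraceRight_tensorId, hN, trace_ptraceRight]

theorem tensorId_sum_smul {ι : Type*} (s : Finset ι) (q : ι → ℂ) (M : ι → SuperOp n)
    (X : Op (n × κ)) :
    tensorId κ (∑ j ∈ s, q j • M j) X = ∑ j ∈ s, q j • tensorId κ (M j) X := by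
  ext p r
  simp only [tensorId, LinearMap.coe_mk, AddHom.coe_mk, of_apply, LinearMap.sum_apply,
    LinearMap.smul_apply, Matrix.sum_apply, Matrix.smul_apply]

/-- Measuring one half of a pure state leaves unnormalised states on the other half; their traces
are absorbed into the weights. -/
theorem isSeparable_of_sum_kronecker [Fintype n] [Fintype κ] {ι : Type*} [Fintype ι]
    {τ : Op (n × κ)} {p : ι → ℝ} {α : ι → Op n} {β : ι → Op κ} (hp : ∀ i, 0 ≤ p i)
    (hα : ∀ i, IsDensity (α i)) (hβ : ∀ i, (β i).PosSemidef)
    (hτ : τ = ∑ i, (p i : ℂ) • (α i ⊗ₖ β i)) (htr : τ.trace = 1) : IsSeparable τ := by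
  classical
  set t : ι → ℝ := fun i => (β i).trace.re with ht
  have ht0 : ∀ i, 0 ≤ t i := fun i => (Complex.nonneg_iff.mp (hβ i).trace_nonneg).1
  have htt : ∀ i, (β i).trace = (t i : ℂ) := fun i =>
    Complex.ext rfl (Complex.nonneg_iff.mp (hβ i).trace_nonneg).2.symm
  have hsum : ∑ i, p i * t i = 1 := by
    refine Complex.ofReal_injective ?_
    rw [Complex.ofReal_one, ← htr, hτ, trace_sum, Complex.ofReal_sum]
    refine Finset.sum_congr rfl fun i _ => ?_
    rw [trace_smul, trace_kronecker, (hα i).2, htt, one_mul, smul_eq_mul, Complex.ofReal_mul]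
  have hnorm : ∀ i, t i ≠ 0 → IsDensity ((t i : ℂ)⁻¹ • β i) := by
    intro i hi
    refine ⟨(hβ i).smul ?_, ?_⟩
    · rw [← Complex.ofReal_inv]
      exact Complex.zero_le_real.mpr (inv_nonneg.mpr (ht0 i))
    · rw [trace_smul, htt, smul_eq_mul, inv_mul_cancel₀ (by exact_mod_cast hi)]
  obtain ⟨i₀, hi₀⟩ : ∃ i, t i ≠ 0 := by
    by_contra hall
    push Not at hall
    simp [hall] at hsum
  -- Terms of trace zero vanish but still need a density matrix in the decomposition; the normalised
  -- `β i₀` is a filler of weight zero.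
  set γ : ι → Op κ := fun i => if t i = 0 then (t i₀ : ℂ)⁻¹ • β i₀ else (t i : ℂ)⁻¹ • β i with hγ
  have hγd : ∀ i, IsDensity (γ i) := by
    intro i
    by_cases hi : t i = 0
    · simpa only [hγ, if_pos hi] using hnorm i₀ hi₀
    · simpa only [hγ, if_neg hi] using hnorm i hi
  have hterm : ∀ i, (p i : ℂ) • (α i ⊗ₖ β i) = ((p i * t i : ℝ) : ℂ) • (α i ⊗ₖ γ i) := by
    intro i
    by_cases hi : t i = 0
    · have h0 : β i = 0 := (hβ i).trace_eq_zero_iff.mp (by rw [htt, hi, Complex.ofReal_zero])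
      rw [hi, h0, mul_zero, Complex.ofReal_zero, zero_smul, kronecker_zero, smul_zero]
    · have hi' : (t i : ℂ) ≠ 0 := by exact_mod_cast hi
      simp only [hγ, if_neg hi]
      rw [kronecker_smul, smul_smul, Complex.ofReal_mul, mul_assoc, mul_inv_cancel₀ hi', mul_one]
  let e := Fintype.equivFin ι
  refine ⟨Fintype.card ι, fun k => p (e.symm k) * t (e.symm k), fun k => α (e.symm k),
    fun k => γ (e.symm k), fun k => mul_nonneg (hp _) (ht0 _), ?_, fun k => hα _, fun k => hγd _, ?_⟩
  · rw [← hsum]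
    exact e.symm.sum_comp fun i => p i * t i
  · rw [hτ, Finset.sum_congr rfl fun i _ => hterm i]
    exact (e.symm.sum_comp fun i => ((p i * t i : ℝ) : ℂ) • (α i ⊗ₖ γ i)).symm

theorem IsDensity.kronecker [Fintype n] [Fintype κ] {α : Op n} {β : Op κ} (hα : IsDensity α)
    (hβ : IsDensity β) : IsDensity (α ⊗ₖ β) := by
  classical
  exact ⟨hα.1.kronecker hβ.1, by rw [trace_kronecker, hα.2, hβ.2, one_mul]⟩

theorem isDensity_sum_smul [Fintype n] {ι : Type*} [Fintype ι] {p : ι → ℝ} {σ : ι → Op n}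
    (hp : ∀ i, 0 ≤ p i) (hp1 : ∑ i, p i = 1) (hσ : ∀ i, IsDensity (σ i)) :
    IsDensity (∑ i, (p i : ℂ) • σ i) := by
  refine ⟨posSemidef_sum _ fun i _ => (hσ i).1.smul (Complex.zero_le_real.mpr (hp i)), ?_⟩
  rw [trace_sum]
  simp only [trace_smul, (hσ _).2, smul_eq_mul, mul_one]
  exact_mod_cast hp1

theorem IsSeparable.isDensity [Fintype n] [Fintype κ] {τ : Op (n × κ)} (h : IsSeparable τ) :
    IsDensity τ := by
  obtain ⟨K, p, α, β, hp, hp1, hα, hβ, rfl⟩ := h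
  exact isDensity_sum_smul hp hp1 fun i => (hα i).kronecker (hβ i)

theorem IsDensity.ptraceRight [Fintype n] [Fintype κ] [DecidableEq κ] {τ : Op (n × κ)}
    (h : IsDensity τ) : IsDensity (ptraceRight τ) := by
  refine ⟨?_, by rw [trace_ptraceRight, h.2]⟩
  have : QInfo.ptraceRight τ = ∑ a, τ.submatrix (fun i => (i, a)) (fun i => (i, a)) := by
    ext i j
    simp only [QInfo.ptraceRight, of_apply, Matrix.sum_apply, submatrix_apply]
  rw [this]
  exact posSemidef_sum _ fun a _ => h.1.submatrix _

/-- The reduction criterion: a separable state is dominated by its marginal. -/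
theorem IsSeparable.reduction [Fintype n] [Fintype κ] [DecidableEq κ] {τ : Op (n × κ)}
    (h : IsSeparable τ) : (ptraceRight τ ⊗ₖ (1 : Op κ) - τ).PosSemidef := by
  classical
  obtain ⟨K, p, α, β, hp, hp1, hα, hβ, rfl⟩ := h
  -- The difference is again a combination of products, now with second factors `1 - β i ≥ 0`.
  have he : ptraceRight (∑ i, (p i : ℂ) • (α i ⊗ₖ β i)) ⊗ₖ (1 : Op κ)
      - ∑ i, (p i : ℂ) • (α i ⊗ₖ β i) = ∑ i, (p i : ℂ) • (α i ⊗ₖ (1 - β i)) := by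
    have h1 : ∀ i, α i ⊗ₖ (1 - β i) = α i ⊗ₖ (1 : Op κ) - α i ⊗ₖ β i := by
      intro i
      ext x y
      simp only [kroneckerMap_apply, Matrix.sub_apply, mul_sub]
    have h2 : (∑ i, (p i : ℂ) • α i) ⊗ₖ (1 : Op κ) = ∑ i, (p i : ℂ) • (α i ⊗ₖ (1 : Op κ)) := by
      ext x y
      simp only [kroneckerMap_apply, Matrix.sum_apply, Matrix.smul_apply, smul_eq_mul, Finset.sum_mul, mul_assoc]
    simp only [ptraceRight_sum, ptraceRight_smul, ptraceRight_kronecker, (hβ _).2, one_smul, h1,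
      smul_sub, Finset.sum_sub_distrib, h2]
  rw [he]
  exact posSemidef_sum _ fun i _ =>
    ((hα i).1.kronecker (hβ i).posSemidef_one_sub).smul (Complex.zero_le_real.mpr (hp i))

theorem IsSeparable.entropy_ptraceRight_le [Fintype n] [DecidableEq n] [Fintype κ] [DecidableEq κ]
    {τ : Op (n × κ)} (h : IsSeparable τ) :
    vonNeumannEntropy (QInfo.ptraceRight τ) ≤ vonNeumannEntropy τ :=
  vonNeumannEntropy_ptraceRight_le h.isDensity.1 h.isDensity.ptraceRight.1 h.reduction

end Bipartite

/-! ### CQ channels and their mixtures break entanglement. -/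

section CQ

/-- The operator `⟨ψ|X|ψ⟩` on the second factor. -/
def braket {n κ : Type*} [Fintype n] (ψ : n → ℂ) (X : Op (n × κ)) : Op κ :=
  Matrix.of fun a b => star ψ ⬝ᵥ ((Matrix.of fun i j => X (i, a) (j, b)) *ᵥ ψ)

theorem braket_ketbra {n κ : Type*} [Fintype n] (ψ : n → ℂ) (Ψ : n × κ → ℂ) :
    braket ψ (ketbra Ψ) = ketbra fun a => star ψ ⬝ᵥ fun i => Ψ (i, a) := by
  ext a b
  rw [braket, of_apply, ketbra_apply]
  have h : (Matrix.of fun i j => ketbra Ψ (i, a) (j, b))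
      = vecMulVec (fun i => Ψ (i, a)) (star fun i => Ψ (i, b)) := rfl
  rw [h, vecMulVec_mulVec, op_smul_eq_smul, dotProduct_smul, smul_eq_mul, mul_comm]
  exact congrArg _ (star_dotProduct _ _)

theorem posSemidef_braket {n κ : Type*} [Fintype n] [Fintype κ] (ψ : n → ℂ) {X : Op (n × κ)}
    (hX : X.PosSemidef) : (braket ψ X).PosSemidef := by
  classical
  -- `B` is the map `v ↦ ψ ⊗ v`.
  let B : Matrix (n × κ) κ ℂ := Matrix.of fun p b => if p.2 = b then ψ p.1 else 0
  have h : braket ψ X = Bᴴ * X * B := by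
    ext a b
    simp only [braket, B, of_apply, mul_apply, conjTranspose_apply, Fintype.sum_prod_type,
      dotProduct, mulVec, Pi.star_apply, apply_ite star, star_zero, ite_mul, zero_mul, mul_ite,
      mul_zero, Finset.sum_ite_eq', Finset.mem_univ, if_true, Finset.mul_sum, Finset.sum_mul]
    rw [Finset.sum_comm]
    exact Finset.sum_congr rfl fun i _ => Finset.sum_congr rfl fun j _ => by ring
  rw [h]
  exact hX.conjTranspose_mul_mul_same B

theorem trace_braket {n κ : Type*} [Fintype n] [Fintype κ] (ψ : n → ℂ) (X : Op (n × κ)) :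
    (braket ψ X).trace = star ψ ⬝ᵥ (ptraceRight X *ᵥ ψ) := by
  have h : ptraceRight X = ∑ a, Matrix.of fun i j => X (i, a) (j, a) := by
    ext i j
    simp only [ptraceRight, of_apply, Matrix.sum_apply]
  rw [h, sum_mulVec, dotProduct_sum]
  rfl

theorem cqMap_apply (ψ : QubitBasis) (σ : Fin 2 → Op (Fin 2)) (ρ : Op (Fin 2)) :
    cqMap ψ σ ρ = ∑ m, (star (ψ m).ofLp ⬝ᵥ (ρ *ᵥ (ψ m).ofLp)) • σ m := rfl

theorem tensorId_cqMap {κ : Type*} (ψ : QubitBasis) (σ : Fin 2 → Op (Fin 2))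
    (X : Op (Fin 2 × κ)) :
    tensorId κ (cqMap ψ σ) X = ∑ m, σ m ⊗ₖ braket (ψ m).ofLp X := by
  ext p q
  simp only [tensorId, LinearMap.coe_mk, AddHom.coe_mk, of_apply, cqMap_apply, Matrix.sum_apply,
    Matrix.smul_apply, kroneckerMap_apply, braket, smul_eq_mul]
  exact Finset.sum_congr rfl fun m _ => mul_comm _ _

theorem trace_cqMap (ψ : QubitBasis) {σ : Fin 2 → Op (Fin 2)} (hσ : ∀ m, IsDensity (σ m))
    (X : Op (Fin 2)) : (cqMap ψ σ X).trace = X.trace := by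
  rw [cqMap_apply, trace_sum, ← trace_eq_sum_basis ψ X]
  refine Finset.sum_congr rfl fun m _ => ?_
  rw [trace_smul, (hσ m).2, smul_eq_mul, mul_one]

/-- Random mixtures of CQ channels are entanglement breaking. -/
theorem isEntanglementBreaking_of_mixture {K : ℕ} {q : Fin K → ℝ} {M : Fin K → SuperOp (Fin 2)}
    {N : SuperOp (Fin 2)} (hM : ∀ j, IsCQChannel (M j)) (hN : IsMixture q M N) :
    IsEntanglementBreaking N := by
  obtain ⟨hq, hq1, rfl⟩ := hN
  choose ψ σ hσ hM using hM
  have hexp : ∀ (k : ℕ) (X : Op (Fin 2 × Fin k)), tensorId (Fin k) (∑ j, (q j : ℂ) • M j) X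
      = ∑ x : Fin K × Fin 2, (q x.1 : ℂ) • (σ x.1 x.2 ⊗ₖ braket (ψ x.1 x.2).ofLp X) := by
    intro k X
    rw [tensorId_sum_smul, Fintype.sum_prod_type]
    refine Finset.sum_congr rfl fun j _ => ?_
    rw [hM, tensorId_cqMap, Finset.smul_sum]
  have htr : ∀ X : Op (Fin 2), ((∑ j, (q j : ℂ) • M j) X).trace = X.trace := by
    intro X
    simp only [LinearMap.sum_apply, LinearMap.smul_apply, trace_sum, trace_smul, hM,
      trace_cqMap _ (hσ _), smul_eq_mul]
    rw [← Finset.sum_mul, ← Complex.ofReal_sum, hq1, Complex.ofReal_one, one_mul]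
  refine ⟨⟨fun k X hX => ?_, htr⟩, fun k Ψ hΨ => ?_⟩
  · rw [hexp]
    exact posSemidef_sum _ fun x _ => ((hσ x.1 x.2).1.kronecker (posSemidef_braket _ hX)).smul
      (Complex.zero_le_real.mpr (hq x.1))
  · exact isSeparable_of_sum_kronecker (ι := Fin K × Fin 2) (fun x => hq x.1)
      (fun x => hσ x.1 x.2)
      (fun x => posSemidef_braket _ hΨ.1) (hexp k _) ((trace_tensorId htr _).trans hΨ.2)

theorem isCQChannel_cqNot (ψ : QubitBasis) : IsCQChannel (cqNot ψ) :=
  ⟨ψ, _, fun m => isDensity_basisProj ψ (m + 1), rfl⟩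

theorem IsCQChannel.isEntanglementBreaking {M : SuperOp (Fin 2)} (hM : IsCQChannel M) :
    IsEntanglementBreaking M :=
  isEntanglementBreaking_of_mixture (K := 1) (q := fun _ => 1) (M := fun _ => M) (fun _ => hM)
    ⟨fun _ => zero_le_one, by simp, by simp⟩

end CQ

/-! ### Upper bound and attainment for the entanglement-assisted capacity. -/

section Capacity

theorem isDensity_ketbra_of_purification {n κ : Type*} [Fintype n] [Fintype κ] {ρ : Op n}
    {Ψ : n × κ → ℂ} (hρ : IsDensity ρ) (hΨ : ptraceRight (ketbra Ψ) = ρ) : IsDensity (ketbra Ψ) :=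
  ⟨posSemidef_ketbra Ψ, by rw [← trace_ptraceRight, hΨ, hρ.2]⟩

/-- The joint output is separable with marginal `N ρ`, so its entropy is at least `S(N ρ)`. -/
theorem IsEntanglementBreaking.mutualInfo_le {d : ℕ} {N : SuperOp (Fin d)}
    (hN : IsEntanglementBreaking N) {ρ : Op (Fin d)} {Ψ : Fin d × Fin d → ℂ} (hρ : IsDensity ρ)
    (hΨ : ptraceRight (ketbra Ψ) = ρ) :
    vonNeumannEntropy ρ + vonNeumannEntropy (N ρ)
      - vonNeumannEntropy (tensorId (Fin d) N (ketbra Ψ)) ≤ vonNeumannEntropy ρ := by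
  have h := (hN.2 d Ψ (isDensity_ketbra_of_purification hρ hΨ)).entropy_ptraceRight_le
  rw [ptraceRight_tensorId, hΨ] at h
  linarith

theorem IsChannel.isDensity_tensorId {d k : ℕ} {N : SuperOp (Fin d)} (hN : IsChannel N)
    {X : Op (Fin d × Fin k)} (hX : IsDensity X) : IsDensity (tensorId (Fin k) N X) :=
  ⟨hN.1 k X hX.1, (trace_tensorId hN.2 X).trans hX.2⟩

theorem isDensity_ketbra_iff {μ : Type*} [Fintype μ] (v : μ → ℂ) :
    IsDensity (ketbra v) ↔ ∑ i, ‖v i‖ ^ 2 = 1 := by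
  have h : (ketbra v).trace = ((∑ i, ‖v i‖ ^ 2 : ℝ) : ℂ) := by
    rw [trace_ketbra, dotProduct, Complex.ofReal_sum]
    refine Finset.sum_congr rfl fun i _ => ?_
    rw [Pi.star_apply, Complex.star_def, Complex.conj_mul', Complex.ofReal_pow]
  rw [IsDensity, and_iff_right (posSemidef_ketbra v), h]
  exact_mod_cast Iff.rfl

theorem isCompact_setOf_isDensity_ketbra (μ : Type*) [Fintype μ] :
    IsCompact {v : μ → ℂ | IsDensity (ketbra v)} := by
  simp only [isDensity_ketbra_iff]
  refine Metric.isCompact_of_isClosed_isBounded ?_ ?_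
  · exact isClosed_eq (by fun_prop) continuous_const
  · refine (Metric.isBounded_closedBall (x := (0 : μ → ℂ)) (r := 1)).subset fun v hv => ?_
    rw [mem_closedBall_zero_iff, pi_norm_le_iff_of_nonneg zero_le_one]
    intro i
    have h := Finset.single_le_sum (f := fun i => ‖v i‖ ^ 2) (fun j _ => sq_nonneg _)
      (Finset.mem_univ i)
    rw [Set.mem_ofPred_eq] at hv
    rw [hv] at h
    exact (sq_le_one_iff₀ (norm_nonneg _)).mp h

theorem continuous_ketbra (μ : Type*) : Continuous (ketbra : (μ → ℂ) → Op μ) := by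
  refine continuous_matrix fun i j => ?_
  simp only [ketbra_apply]
  fun_prop

/-- The purification determines `ρ`, so the maximum runs over the compact set of unit vectors alone.
-/
theorem mutualInfoValues_eq_image {d : ℕ} (N : SuperOp (Fin d)) :
    mutualInfoValues N = (fun Ψ : Fin d × Fin d → ℂ =>
      vonNeumannEntropy (ptraceRight (ketbra Ψ)) + vonNeumannEntropy (N (ptraceRight (ketbra Ψ)))
        - vonNeumannEntropy (tensorId (Fin d) N (ketbra Ψ))) '' {Ψ | IsDensity (ketbra Ψ)} := by
  ext x
  constructor
  · rintro ⟨ρ, Ψ, hρ, rfl, rfl⟩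
    exact ⟨Ψ, isDensity_ketbra_of_purification hρ rfl, rfl⟩
  · rintro ⟨Ψ, hΨ, rfl⟩
    exact ⟨_, Ψ, IsDensity.ptraceRight hΨ, rfl, rfl⟩

/-- The maximum that defines the entanglement-assisted capacity of a channel is attained. -/
theorem IsChannel.isGreatest_eaCapacity {d : ℕ} [NeZero d] {N : SuperOp (Fin d)}
    (hN : IsChannel N) : IsGreatest (mutualInfoValues N) (eaCapacity N) := by
  have hp : Continuous fun Ψ : Fin d × Fin d → ℂ => ptraceRight (ketbra Ψ) := by
    refine continuous_matrix fun i j => ?_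
    simp only [ptraceRight, of_apply, ketbra_apply]
    fun_prop
  have hNp := (LinearMap.continuous_of_finiteDimensional N).comp hp
  have hT := (LinearMap.continuous_of_finiteDimensional (tensorId (Fin d) N)).comp
    (continuous_ketbra (Fin d × Fin d))
  have hd : ∀ Ψ ∈ {Ψ : Fin d × Fin d → ℂ | IsDensity (ketbra Ψ)},
      IsDensity (N (ptraceRight (ketbra Ψ))) := by
    intro Ψ hΨ
    rw [← ptraceRight_tensorId]
    exact (hN.isDensity_tensorId hΨ).ptraceRight
  have hcont := ((continuousOn_vonNeumannEntropy hp.continuousOn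
    fun Ψ (hΨ : Ψ ∈ {Ψ : Fin d × Fin d → ℂ | IsDensity (ketbra Ψ)}) =>
      IsDensity.ptraceRight hΨ).add
    (continuousOn_vonNeumannEntropy hNp.continuousOn hd)).sub
    (continuousOn_vonNeumannEntropy hT.continuousOn fun Ψ hΨ => hN.isDensity_tensorId hΨ)
  have hne : {Ψ : Fin d × Fin d → ℂ | IsDensity (ketbra Ψ)}.Nonempty := by
    refine ⟨Pi.single (0, 0) 1, (isDensity_ketbra_iff _).mpr ?_⟩
    rw [Finset.sum_eq_single (0, 0)]
    · simp
    · intro b _ hb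
      simp [hb]
    · simp
  rw [eaCapacity, mutualInfoValues_eq_image]
  exact ((isCompact_setOf_isDensity_ketbra _).image_of_continuousOn hcont).isGreatest_sSup
    (hne.image _)

end Capacity

/-! ### Capacity of the basic NOT channels, and rigidity of CQ decompositions. -/

section NOT

theorem cqNot_smul_one (ψ : QubitBasis) (c : ℂ) : cqNot ψ (c • 1) = c • 1 := by
  rw [cqNot, cqMap_apply]
  conv_rhs => rw [← sum_basisProj_succ ψ, Finset.smul_sum]
  refine Finset.sum_congr rfl fun m _ => ?_
  rw [smul_mulVec, one_mulVec, dotProduct_smul, basis_dotProduct, if_pos rfl,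
    smul_eq_mul, mul_one]

/-- The output is `∑ m, Pₘ₊₁ ⊗ |vₘ⟩⟨vₘ|` with `‖vₘ‖² = 1/2`. Orthogonality of the first factors
removes the cross terms, so it is half a projector. -/
theorem tensorId_cqNot_mul_self (ψ : QubitBasis) {κ : Type*} [Fintype κ] {Ψ : Fin 2 × κ → ℂ}
    (hΨ : ptraceRight (ketbra Ψ) = (1 / 2 : ℂ) • 1) :
    tensorId κ (cqNot ψ) (ketbra Ψ) * tensorId κ (cqNot ψ) (ketbra Ψ)
      = (1 / 2 : ℂ) • tensorId κ (cqNot ψ) (ketbra Ψ) := by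
  have hb : ∀ m, braket (ψ m).ofLp (ketbra Ψ) * braket (ψ m).ofLp (ketbra Ψ)
      = (1 / 2 : ℂ) • braket (ψ m).ofLp (ketbra Ψ) := by
    intro m
    have ht := trace_braket (ψ m).ofLp (ketbra Ψ)
    rw [hΨ, smul_mulVec, one_mulVec, dotProduct_smul, basis_dotProduct, if_pos rfl, smul_eq_mul,
      mul_one, braket_ketbra, trace_ketbra] at ht
    rw [braket_ketbra, ketbra_mul_ketbra, ht, ketbra]
  rw [cqNot, tensorId_cqMap, Finset.sum_mul_sum, Finset.smul_sum]
  refine Finset.sum_congr rfl fun m _ => ?_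
  rw [Finset.sum_eq_single m]
  · rw [← mul_kronecker_mul, basisProj_mul, if_pos rfl, hb, kronecker_smul]
  · intro l _ hl
    rw [← mul_kronecker_mul, basisProj_mul, if_neg, zero_kronecker]
    exact fun h => hl (add_right_cancel h).symm
  · exact fun h => absurd (Finset.mem_univ m) h

theorem isDensity_half_one : IsDensity ((1 / 2 : ℂ) • (1 : Op (Fin 2))) := by
  refine ⟨PosSemidef.one.smul ?_, by simp⟩
  rw [show (1 / 2 : ℂ) = ((1 / 2 : ℝ) : ℂ) by push_cast; rfl]
  exact Complex.zero_le_real.mpr (by norm_num)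

theorem vonNeumannEntropy_half_one : vonNeumannEntropy ((1 / 2 : ℂ) • (1 : Op (Fin 2))) = 1 :=
  vonNeumannEntropy_eq_one isDensity_half_one (by rw [smul_mul_smul_comm, one_mul, smul_smul])

theorem exists_purification_half_one :
    ∃ Ψ : Fin 2 × Fin 2 → ℂ, ptraceRight (ketbra Ψ) = (1 / 2 : ℂ) • (1 : Op (Fin 2)) := by
  refine ⟨fun p => if p.1 = p.2 then ((Real.sqrt 2)⁻¹ : ℝ) else 0, ?_⟩
  have h : (((Real.sqrt 2)⁻¹ : ℝ) : ℂ) * star (((Real.sqrt 2)⁻¹ : ℝ) : ℂ) = 1 / 2 := by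
    rw [Complex.star_def, Complex.conj_ofReal, ← Complex.ofReal_mul, ← mul_inv,
      Real.mul_self_sqrt zero_le_two]
    simp
  ext i j
  simp only [ptraceRight, of_apply, ketbra_apply, Fin.sum_univ_two]
  fin_cases i <;> fin_cases j <;> simp [← h]

/-- The channel that measures a basis and prepares the orthogonal state has capacity one. -/
theorem eaCapacity_cqNot (ψ : QubitBasis) : eaCapacity (cqNot ψ) = 1 := by
  have hEB := (isCQChannel_cqNot ψ).isEntanglementBreaking
  refine IsGreatest.csSup_eq ⟨?_, ?_⟩
  · obtain ⟨Ψ, hΨ⟩ := exists_purification_half_one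
    have hd := isDensity_ketbra_of_purification isDensity_half_one hΨ
    refine ⟨_, Ψ, isDensity_half_one, hΨ, ?_⟩
    rw [cqNot_smul_one, vonNeumannEntropy_half_one,
      vonNeumannEntropy_eq_one (hEB.1.isDensity_tensorId hd) (tensorId_cqNot_mul_self ψ hΨ)]
    ring
  · rintro _ ⟨ρ, Ψ, hρ, hΨ, rfl⟩
    exact (hEB.mutualInfo_le hρ hΨ).trans (qubit_entropy_le_one hρ)

/-- The trace of a superoperator as a linear map on operators. -/
def superTrace {n : Type*} [Fintype n] [DecidableEq n] (N : SuperOp n) : ℂ :=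
  ∑ i, ∑ j, N (Matrix.single i j 1) i j

theorem superTrace_sum_smul {n ι : Type*} [Fintype n] [DecidableEq n] (s : Finset ι) (q : ι → ℂ)
    (M : ι → SuperOp n) : superTrace (∑ j ∈ s, q j • M j) = ∑ j ∈ s, q j * superTrace (M j) := by
  simp only [superTrace, LinearMap.sum_apply, LinearMap.smul_apply, Matrix.sum_apply,
    Matrix.smul_apply, smul_eq_mul, Finset.mul_sum]
  exact (Finset.sum_congr rfl fun i _ => Finset.sum_comm).trans Finset.sum_comm

/-- For states `σ m` each term is nonnegative, so superoperator traces of CQ channels cannot cancel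
in a mixture. -/
theorem superTrace_cqMap (ψ : QubitBasis) (σ : Fin 2 → Op (Fin 2)) :
    superTrace (cqMap ψ σ) = ∑ m, star (ψ m).ofLp ⬝ᵥ (σ m *ᵥ (ψ m).ofLp) := by
  simp only [superTrace, cqMap_apply, Matrix.sum_apply, Matrix.smul_apply, smul_eq_mul]
  simp only [Fin.sum_univ_two, dotProduct, mulVec, Pi.star_apply, Matrix.single_apply]
  simp
  ring

theorem superTrace_cqNot (ψ : QubitBasis) : superTrace (cqNot ψ) = 0 := by
  rw [cqNot, superTrace_cqMap]
  refine Finset.sum_eq_zero fun m _ => ?_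
  have h := basis_dotProduct_succ ψ m
  rw [basisProj, ketbra_mulVec, dotProduct_smul, h, smul_zero]

/-- A positive operator with zero expectation in `ψ m` annihilates `ψ m`. By hermiticity it lives on
the orthogonal line, and the trace fixes the scalar. -/
theorem eq_basisProj_succ_of_expectation_zero (ψ : QubitBasis) (m : Fin 2) {σ : Op (Fin 2)}
    (hσ : IsDensity σ) (h : star (ψ m).ofLp ⬝ᵥ (σ *ᵥ (ψ m).ofLp) = 0) :
    σ = basisProj ψ (m + 1) := by
  have h1 : σ * basisProj ψ m = 0 := by
    rw [basisProj, ketbra, mul_vecMulVec, (hσ.1.dotProduct_mulVec_zero_iff _).mp h, zero_vecMulVec]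
  have h2 : σ * basisProj ψ (m + 1) = σ := by
    conv_rhs => rw [← mul_one σ, ← basisProj_add_succ ψ m, mul_add, h1, zero_add]
  have h3 : basisProj ψ (m + 1) * σ = σ := by
    have h4 := congrArg conjTranspose h2
    rwa [conjTranspose_mul, (isDensity_basisProj ψ (m + 1)).isHermitian.eq,
      hσ.isHermitian.eq] at h4
  set c := star (ψ (m + 1)).ofLp ⬝ᵥ (σ *ᵥ (ψ (m + 1)).ofLp) with hc
  have h5 : σ = c • basisProj ψ (m + 1) := by
    conv_lhs => rw [← h3, ← h2]
    rw [basisProj, ketbra, mul_vecMulVec, vecMulVec_mul_vecMulVec, vecMulVec_smul]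
  have h6 := congrArg trace h5
  rw [hσ.2, trace_smul, (isDensity_basisProj ψ (m + 1)).2, smul_eq_mul, mul_one] at h6
  rw [h5, ← h6, one_smul]

/-- In every decomposition of a quantum NOT channel into CQ channels, the channels of positive
weight measure a basis and prepare the orthogonal basis state. -/
theorem IsQuantumNOT.exists_eq_cqNot {N : SuperOp (Fin 2)} (hN : IsQuantumNOT N) {K : ℕ}
    {q : Fin K → ℝ} {M : Fin K → SuperOp (Fin 2)} (hM : ∀ j, IsCQChannel (M j))
    (hmix : IsMixture q M N) (j : Fin K) (hj : 0 < q j) : ∃ ψ, M j = cqNot ψ := by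
  have h0 : superTrace N = 0 := by
    obtain ⟨K', q', ψ', _, ⟨_, _, rfl⟩, _⟩ := hN
    rw [superTrace_sum_smul]
    exact Finset.sum_eq_zero fun i _ => by rw [superTrace_cqNot, mul_zero]
  obtain ⟨hq, -, rfl⟩ := hmix
  choose ψ σ hσ hM using hM
  have hnn : ∀ i m, 0 ≤ star (ψ i m).ofLp ⬝ᵥ (σ i m *ᵥ (ψ i m).ofLp) := fun i m =>
    (hσ i m).1.dotProduct_mulVec_nonneg _
  have hst : ∀ i, 0 ≤ superTrace (M i) := by
    intro i
    rw [hM, superTrace_cqMap]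
    exact Finset.sum_nonneg fun m _ => hnn i m
  rw [superTrace_sum_smul, Finset.sum_eq_zero_iff_of_nonneg fun i _ =>
    mul_nonneg (Complex.zero_le_real.mpr (hq i)) (hst i)] at h0
  have hj0 : superTrace (M j) = 0 :=
    (mul_eq_zero.mp (h0 j (Finset.mem_univ j))).resolve_left (by exact_mod_cast hj.ne')
  rw [hM, superTrace_cqMap, Finset.sum_eq_zero_iff_of_nonneg fun m _ => hnn j m] at hj0
  refine ⟨ψ j, ?_⟩
  rw [hM, cqNot]
  congr 1
  funext m
  exact eq_basisProj_succ_of_expectation_zero (ψ j) m (hσ j m) (hj0 m (Finset.mem_univ m))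

end NOT

/-! ### Strict inequality for quantum NOT channels. -/

section Strict

theorem purification_sum {n κ : Type*} [Fintype n] [DecidableEq n] [Fintype κ] {Ψ : n × κ → ℂ}
    {c : ℂ} (hΨ : ptraceRight (ketbra Ψ) = c • 1) (i j : n) :
    ∑ a, Ψ (i, a) * star (Ψ (j, a)) = if i = j then c else 0 := by
  have h := congrFun (congrFun hΨ i) j
  rw [Matrix.smul_apply, one_apply, smul_eq_mul, mul_ite, mul_one, mul_zero] at h
  exact h

/-- A superoperator is determined by its action on half of a maximally entangled vector. -/
theorem eq_of_tensorId_ketbra_eq {n κ : Type*} [Fintype n] [DecidableEq n] [Fintype κ]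
    {Ψ : n × κ → ℂ} {c : ℂ} (hc : c ≠ 0) (hΨ : ptraceRight (ketbra Ψ) = c • 1)
    {N M : SuperOp n} (h : tensorId κ N (ketbra Ψ) = tensorId κ M (ketbra Ψ)) : N = M := by
  have hab : ∀ a b, N (Matrix.of fun i j => ketbra Ψ (i, a) (j, b))
      = M (Matrix.of fun i j => ketbra Ψ (i, a) (j, b)) := by
    intro a b
    ext i j
    exact congrFun (congrFun h (i, a)) (j, b)
  -- Read as a matrix, `Ψ` satisfies `ΨΨᴴ = c • 1`, so `c² X = Ψ(ΨᴴXΨ)Ψᴴ`; expanding the middle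
  -- factor shows that the blocks of `ketbra Ψ` span all operators.
  have hexp : ∀ X : Op n, (c * c) • X = ∑ a, ∑ b,
      (∑ k, ∑ l, star (Ψ (k, a)) * X k l * Ψ (l, b)) •
        (Matrix.of fun i j => ketbra Ψ (i, a) (j, b) : Op n) := by
    intro X
    ext i j
    simp only [Matrix.smul_apply, Matrix.sum_apply, of_apply, ketbra_apply, smul_eq_mul]
    have e1 : ∀ a b, (∑ k, ∑ l, star (Ψ (k, a)) * X k l * Ψ (l, b)) *
        (Ψ (i, a) * star (Ψ (j, b)))
        = ∑ k, ∑ l, X k l * ((Ψ (i, a) * star (Ψ (k, a))) * (Ψ (l, b) * star (Ψ (j, b)))) := by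
      intro a b
      simp only [Finset.sum_mul]
      exact Finset.sum_congr rfl fun k _ => Finset.sum_congr rfl fun l _ => by ring
    have e2 : ∀ k l, ∑ a, ∑ b, X k l * ((Ψ (i, a) * star (Ψ (k, a))) *
        (Ψ (l, b) * star (Ψ (j, b))))
        = X k l * ((if i = k then c else 0) * (if l = j then c else 0)) := by
      intro k l
      rw [← purification_sum hΨ i k, ← purification_sum hΨ l j, Finset.sum_mul_sum,
        Finset.mul_sum]
      exact Finset.sum_congr rfl fun a _ => (Finset.mul_sum _ _ _).symm
    simp only [e1]
    calc c * c * X i j = ∑ k, ∑ l, X k l * ((if i = k then c else 0) * (if l = j then c else 0)) := by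
          simp
          ring
      _ = ∑ k, ∑ l, ∑ a, ∑ b, X k l * ((Ψ (i, a) * star (Ψ (k, a))) *
            (Ψ (l, b) * star (Ψ (j, b)))) := by simp only [e2]
      _ = ∑ k, ∑ a, ∑ b, ∑ l, X k l * ((Ψ (i, a) * star (Ψ (k, a))) *
            (Ψ (l, b) * star (Ψ (j, b)))) := Finset.sum_congr rfl fun k _ =>
              Finset.sum_comm.trans (Finset.sum_congr rfl fun a _ => Finset.sum_comm)
      _ = _ := Finset.sum_comm.trans (Finset.sum_congr rfl fun a _ => Finset.sum_comm)
  refine LinearMap.ext fun X => ?_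
  have h1 : (c * c) • N X = (c * c) • M X := by
    rw [← map_smul, ← map_smul, hexp X]
    simp only [map_sum, map_smul, hab]
  exact smul_right_injective _ (mul_ne_zero hc hc) h1

theorem basisProj_eq_cqNot (ψ : QubitBasis) (m : Fin 2) :
    cqNot ψ (basisProj ψ (m + 1)) = basisProj ψ m := by
  rw [cqNot, cqMap_apply, Finset.sum_eq_single (m + 1)]
  · rw [basisProj, ketbra_mulVec, dotProduct_smul, basis_dotProduct, if_pos rfl, smul_eq_mul,
      mul_one, one_smul]
    fin_cases m <;> rfl
  · intro l _ hl
    rw [basisProj, ketbra_mulVec, dotProduct_smul, basis_dotProduct, if_neg (Ne.symm hl), zero_smul, zero_smul]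
  · exact fun h => absurd (Finset.mem_univ _) h

theorem commute_basisProj (ψ : QubitBasis) (m l : Fin 2) :
    Commute (basisProj ψ m) (basisProj ψ l) := by
  rw [commute_iff_eq, basisProj_mul, basisProj_mul]
  by_cases h : m = l
  · rw [h]
  · rw [if_neg h, if_neg (Ne.symm h)]

/-- Each projector of `ψ` is a value of `cqNot ψ`, whereas every value of `cqNot φ` commutes with
the projectors of `φ`. -/
theorem Incompatible.cqNot_ne {ψ φ : QubitBasis} (h : Incompatible ψ φ) : cqNot ψ ≠ cqNot φ := by
  obtain ⟨m, l, h⟩ := h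
  intro heq
  refine h ?_
  rw [← basisProj_eq_cqNot ψ m, heq, cqNot, cqMap_apply]
  exact Commute.sum_left _ _ _ fun k _ => (commute_basisProj φ (k + 1) l).smul_left _

/-- If a convex combination of states proportional to rank-two projectors is again of that form,
then all the states of positive weight agree with it. -/
theorem eq_of_sum_smul_mul_self {n : Type*} [Fintype n] {ι : Type*} [Fintype ι] {q : ι → ℝ}
    {σ : ι → Op n} {τ : Op n} (hq : ∀ i, 0 < q i) (hq1 : ∑ i, q i = 1)
    (hσ : ∀ i, IsDensity (σ i)) (hσ2 : ∀ i, σ i * σ i = (1 / 2 : ℂ) • σ i) (hτ : IsDensity τ)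
    (hτ2 : τ * τ = (1 / 2 : ℂ) • τ) (h : τ = ∑ i, (q i : ℂ) • σ i) (i : ι) : σ i = τ := by
  have hH : ∀ i, (σ i - τ)ᴴ = σ i - τ := fun i => by
    rw [conjTranspose_sub, (hσ i).isHermitian.eq, hτ.isHermitian.eq]
  have hq1' : ∑ i, (q i : ℂ) = 1 := by exact_mod_cast hq1
  -- The Hilbert-Schmidt variance is `∑ q i Tr (σ i)² - Tr τ²`, and every purity here is 1/2.
  have hvar : ∑ i, (q i : ℂ) * ((σ i - τ)ᴴ * (σ i - τ)).trace = 0 := by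
    have hterm : ∀ i, (q i : ℂ) * ((σ i - τ)ᴴ * (σ i - τ)).trace
        = (q i : ℂ) - ((q i : ℂ) • σ i * τ).trace - (τ * (q i : ℂ) • σ i).trace := by
      intro i
      rw [hH, sub_mul, mul_sub, mul_sub, hσ2, hτ2]
      simp only [trace_sub, trace_smul, (hσ i).2, hτ.2, smul_mul, Matrix.mul_smul, smul_eq_mul]
      ring
    rw [Finset.sum_congr rfl fun i _ => hterm i, Finset.sum_sub_distrib, Finset.sum_sub_distrib,
      hq1', ← trace_sum, ← trace_sum, ← Finset.sum_mul, ← Finset.mul_sum, ← h, hτ2, trace_smul,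
      hτ.2]
    norm_num
  have hnn : ∀ i, 0 ≤ ((σ i - τ)ᴴ * (σ i - τ)).trace := fun i =>
    (posSemidef_conjTranspose_mul_self _).trace_nonneg
  rw [Finset.sum_eq_zero_iff_of_nonneg fun i _ =>
    mul_nonneg (Complex.zero_le_real.mpr (hq i).le) (hnn i)] at hvar
  have h0 := (mul_eq_zero.mp (hvar i (Finset.mem_univ i))).resolve_left
    (by exact_mod_cast (hq i).ne')
  exact sub_eq_zero.mp (trace_conjTranspose_mul_self_eq_zero_iff.mp h0)

theorem IsQuantumNOT.isEntanglementBreaking {N : SuperOp (Fin 2)} (hN : IsQuantumNOT N) :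
    IsEntanglementBreaking N := by
  obtain ⟨K, q, ψ, _, hmix, _⟩ := hN
  exact isEntanglementBreaking_of_mixture (fun j => isCQChannel_cqNot (ψ j)) hmix

theorem IsQuantumNOT.mutualInfo_lt_one {N : SuperOp (Fin 2)} (hN : IsQuantumNOT N) {x : ℝ}
    (hx : x ∈ mutualInfoValues N) : x < 1 := by
  have hEB := hN.isEntanglementBreaking
  obtain ⟨ρ, Ψ, hρ, hΨ, rfl⟩ := hx
  by_contra hge
  rw [not_lt] at hge
  have hρ1 := hge.trans (hEB.mutualInfo_le hρ hΨ)
  obtain rfl := qubit_eq_of_one_le_entropy hρ hρ1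
  have hΨd := isDensity_ketbra_of_purification hρ hΨ
  obtain ⟨K, q, ψ, hq, ⟨_, hq1, rfl⟩, i, j, hij⟩ := hN
  set N : SuperOp (Fin 2) := ∑ j, (q j : ℂ) • cqNot (ψ j) with hNdef
  have hq1' : ∑ i, (q i : ℂ) = 1 := by exact_mod_cast hq1
  have hunital : N ((1 / 2 : ℂ) • 1) = (1 / 2 : ℂ) • 1 := by
    rw [hNdef, LinearMap.sum_apply]
    simp only [LinearMap.smul_apply, cqNot_smul_one]
    rw [← Finset.sum_smul, hq1', one_smul]
  have hsep := hEB.2 2 Ψ hΨd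
  have hmarg : ptraceRight (tensorId (Fin 2) N (ketbra Ψ)) = (1 / 2 : ℂ) • 1 := by
    rw [ptraceRight_tensorId, hΨ, hunital]
  have hred := hsep.reduction
  rw [hmarg, smul_kronecker, one_kronecker_one,
    show (1 / 2 : ℂ) = ((2⁻¹ : ℝ) : ℂ) by push_cast; norm_num] at hred
  -- The first two entropies are both 1, so a value of at least 1 leaves at most one bit for the
  -- joint output.
  rw [hunital, vonNeumannEntropy_half_one] at hge
  have hproj := mul_self_eq_of_entropy_le_one hsep.isDensity
    (eigenvalues_le_of_posSemidef hsep.isDensity.isHermitian hred) (by linarith)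
  have hall := eq_of_sum_smul_mul_self hq hq1
    (fun k => (isCQChannel_cqNot (ψ k)).isEntanglementBreaking.1.isDensity_tensorId hΨd)
    (fun k => tensorId_cqNot_mul_self (ψ k) hΨ) hsep.isDensity hproj
    (tensorId_sum_smul _ _ _ _)
  exact hij.cqNot_ne (eq_of_tensorId_ketbra_eq (by norm_num) hΨ ((hall i).trans (hall j).symm))

theorem IsQuantumNOT.not_isNoisyCQMixture {N : SuperOp (Fin 2)} (hN : IsQuantumNOT N) :
    ¬ IsNoisyCQMixture N := by
  rintro ⟨K, q, M, hM, hmix, hcap⟩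
  obtain ⟨j, hj⟩ : ∃ j, 0 < q j := by
    by_contra hall
    push Not at hall
    have := Finset.sum_nonpos fun j (_ : j ∈ Finset.univ) => hall j
    rw [hmix.2.1] at this
    exact absurd this (by norm_num)
  obtain ⟨ψ, hψ⟩ := hN.exists_eq_cqNot hM hmix j hj
  have := hcap j hj
  rw [hψ, eaCapacity_cqNot] at this
  exact lt_irrefl _ this

end Strict

/-! ### A quantum NOT channel from two incompatible bases. -/

section Existence

/-- The basis `(3, 4)/5`, `(-4, 3)/5`. -/
def rotatedVec (m : Fin 2) : EuclideanSpace ℂ (Fin 2) :=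
  if m = 0 then !₂[3 / 5, 4 / 5] else !₂[-4 / 5, 3 / 5]

theorem orthonormal_rotatedVec : Orthonormal ℂ rotatedVec := by
  rw [orthonormal_iff_ite]
  intro i j
  rw [EuclideanSpace.inner_eq_star_dotProduct]
  fin_cases i <;> fin_cases j <;>
    simp [rotatedVec, dotProduct, Fin.sum_univ_two, Complex.conj_ofNat] <;> norm_num

def rotatedBasis : QubitBasis :=
  (basisOfOrthonormalOfCardEqFinrank orthonormal_rotatedVec (by simp)).toOrthonormalBasis
    (by simpa using orthonormal_rotatedVec)

theorem rotatedBasis_apply (m : Fin 2) : rotatedBasis m = rotatedVec m := by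
  simp [rotatedBasis]

theorem incompatible_rotatedBasis :
    Incompatible (EuclideanSpace.basisFun (Fin 2) ℂ) rotatedBasis := by
  refine ⟨0, 0, fun h => ?_⟩
  -- This entry is 12/25 for one order of the product and 0 for the other.
  have h1 := congrFun (congrFun h.eq 0) 1
  rw [basisProj, basisProj, rotatedBasis_apply] at h1
  simp [mul_apply, ketbra_apply, rotatedVec, Fin.sum_univ_two] at h1

theorem exists_isQuantumNOT : ∃ N, IsQuantumNOT N := by
  refine ⟨_, 2, fun _ => 1 / 2, ![EuclideanSpace.basisFun (Fin 2) ℂ, rotatedBasis],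
    fun _ => by norm_num, ⟨fun _ => by norm_num, by simp, rfl⟩, 0, 1, ?_⟩
  exact incompatible_rotatedBasis

end Existence

end QInfo
end

/-- The conjuncts `IsGreatest` say that the maximum that defines the capacity is attained. -/
theorem mainTheorem12 :
    (∀ N : QInfo.SuperOp (Fin 2), QInfo.IsQuantumNOT N →
      (∀ (K : ℕ) (q : Fin K → ℝ) (M : Fin K → QInfo.SuperOp (Fin 2)),
        (∀ j, QInfo.IsCQChannel (M j)) → QInfo.IsMixture q M N →
        ∀ j, 0 < q j →
          IsGreatest (QInfo.mutualInfoValues (M j)) (QInfo.eaCapacity (M j)) ∧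
          QInfo.eaCapacity (M j) = 1) ∧
      QInfo.IsEntanglementBreaking N ∧
      IsGreatest (QInfo.mutualInfoValues N) (QInfo.eaCapacity N) ∧
      QInfo.eaCapacity N < 1 ∧
      ¬ QInfo.IsNoisyCQMixture N) ∧
    ∃ N : QInfo.SuperOp (Fin 2), QInfo.IsQuantumNOT N ∧ QInfo.IsEntanglementBreaking N ∧
      IsGreatest (QInfo.mutualInfoValues N) (QInfo.eaCapacity N) ∧
      QInfo.eaCapacity N < 1 ∧ ¬ QInfo.IsNoisyCQMixture N := by

  have hmain : ∀ N : QInfo.SuperOp (Fin 2), QInfo.IsQuantumNOT N →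
      QInfo.IsEntanglementBreaking N ∧
      IsGreatest (QInfo.mutualInfoValues N) (QInfo.eaCapacity N) ∧
      QInfo.eaCapacity N < 1 ∧ ¬ QInfo.IsNoisyCQMixture N := fun N hN =>
    have hEB := hN.isEntanglementBreaking
    have hgr := hEB.1.isGreatest_eaCapacity
    ⟨hEB, hgr, hN.mutualInfo_lt_one hgr.1, hN.not_isNoisyCQMixture⟩
  refine ⟨fun N hN => ⟨fun K q M hM hmix j hj => ?_, hmain N hN⟩, ?_⟩
  · refine ⟨(hM j).isEntanglementBreaking.1.isGreatest_eaCapacity, ?_⟩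
    obtain ⟨ψ, hψ⟩ := hN.exists_eq_cqNot hM hmix j hj
    rw [hψ, QInfo.eaCapacity_cqNot]
  · obtain ⟨N, hN⟩ := QInfo.exists_isQuantumNOT
    exact ⟨N, hN, hmain N hN⟩
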